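/- Let $K$ be a field of characteristic zero and let $q,y\in K$. Write $[m]_q=1+q+\dots+q^{m-1}$, $m!_q=[1]_q[2]_q\cdots[m]_q$, and ${m\brack k}_q=\frac{m!_q}{k!_q\,(m-k)!_q}$ for $0\le k\le m$, and suppose that $[m]_q\neq 0$ for all $m\ge 1$ (for example $q,y$ may be indeterminates). The $q$-Laguerre polynomials $L_n(x;q)\in K[x]$ are given by $L_0(x;q)=1$, $L_1(x;q)=x-y$ and $$L_{n+1}(x;q)=\bigl(x-y[n+1]_q-[n]_q\bigr)L_n(x;q)-y[n]_q^2\,L_{n-1}(x;q)\qquad(n\ge 1).$$ The Al-Salam-Chihara polynomials are given by $Q_0=1$, $Q_{-1}=0$ and $Q_{n+1}(x;\alpha,\beta|q)=(2x-(\alpha+\beta)q^n)Q_n(x;\alpha,\beta|q)-(1-q^n)(1-\alpha\beta q^{n-1})Q_{n-1}(x;\alpha,\beta|q)$ for $n\ge 0$ (for $n=0$ the last term is read as $0$). For a permutation $\sigma$ of $\{1,\dots,n\}$ let $$\mathrm{wex}(\sigma)=\#\{i: i\le\sigma(i)\},\qquad \mathrm{cr}(\sigma)=\sum_{i=1}^n\#\{j: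 j<i\le\sigma(j)<\sigma(i)\}+\sum_{i=1}^n\#\{j: j>i>\sigma(j)>\sigma(i)\}.$$ Let $\mathcal L_q:K[x]\to K$ be the linear functional with $\mathcal L_q(x^n)=\sum_{\sigma\in S_n}y^{\mathrm{wex}(\sigma)}q^{\mathrm{cr}(\sigma)}$ for all $n\ge 0$, and put $I(n_1,\dots,n_k)=\mathcal L_q\bigl(L_{n_1}(x;q)\cdots L_{n_k}(x;q)\bigr)$. Then: (i) if $q\ne 1$, then for every $r\in K$ with $r\neq 0$ and $r^2=y$, and for all $n\ge 0$, $$L_n(x;q)=\Bigl(\frac{r}{q-1}\Bigr)^n Q_n\Bigl(\frac{(q-1)x+y+1}{2r};\frac1r,\,rq\,\Big|\,q\Bigr);$$ (ii) for all integers $n_1,n_2,n_3\ge 0$, $$I(n_1,n_2,n_3)=\sum_{s}\frac{n_1!_q\,n_2!_q\,n_3!_q\,s!_q\,y^s}{(n_1+n_2+n_3-2s)!_q\,(s-n_3)!_q\,(s-n_2)!_q\,(s-n_1)!_q}\sum_{k=0}^{n_1+n_2+n_3-2s}{n_1+n_2+n_3-2s\brack k}_q\,y^k\,q^{\binom{k+1}{2}+\binom{n_1+n_2+n_3-2s-k}{2}},$$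 where $s$ runs over the integers with $\max(n_1,n_2,n_3)\le s$ and $2s\le n_1+n_2+n_3$. -/

import Mathlib

open Polynomial

namespace QLaguerre

/-- The `q`-integer `[n]_q = 1 + q + ... + q ^ (n - 1)`. -/
def qInt {R : Type*} [CommRing R] (q : R) (n : ℕ) : R :=
  ∑ i ∈ Finset.range n, q ^ i

/-- The `q`-factorial `n!_q = [1]_q [2]_q ... [n]_q`. -/
def qFact {R : Type*} [CommRing R] (q : R) (n : ℕ) : R :=
  ∏ i ∈ Finset.range n, qInt q (i + 1)

/-- The `q`-binomial coefficient `n!_q / (k!_q (n - k)!_q)`, which is zero for `k > n`. -/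
def qBinom {K : Type*} [Field K] (q : K) (n k : ℕ) : K :=
  if k ≤ n then qFact q n / (qFact q k * qFact q (n - k)) else 0

/-- The Al-Salam-Chihara polynomials `Q_n(x; α, β | q)`: `Q_0 = 1`, `Q_{-1} = 0` and
`Q_{n+1} = (2 x - (α + β) q ^ n) Q_n - (1 - q ^ n) (1 - α β q ^ (n - 1)) Q_{n-1}`.
For `n = 0` the last term vanishes, which gives `Q_1 = 2 x - (α + β)`. -/
noncomputable def alSalamChihara {R : Type*} [CommRing R] (α β q : R) : ℕ → R[X]
  | 0 => 1
  | 1 => 2 * X - C (α + β)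
  | n + 2 =>
      (2 * X - C ((α + β) * q ^ (n + 1))) * alSalamChihara α β q (n + 1)
        - C ((1 - q ^ (n + 1)) * (1 - α * β * q ^ n)) * alSalamChihara α β q n

/-- The rescaled Al-Salam-Chihara polynomial
`(r / (q - 1)) ^ n * Q_n (((q - 1) x + y + 1) / (2 r); 1 / r, r q | q)`,
where `r` is a square root of `y`. -/
noncomputable def rescaledAlSalamChihara {K : Type*} [Field K] (q y r : K) (n : ℕ) : K[X] :=
  C ((r / (q - 1)) ^ n) *
    (alSalamChihara (1 / r) (r * q) q n).comp
      (C (1 / (2 * r)) * (C (q - 1) * X + C (y + 1)))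

/-- The monic `q`-Laguerre polynomials `L_n(x; q)`, with parameter `y`: `L_0 = 1`, `L_{-1} = 0` and
`L_{n+1} = (x - y [n+1]_q - [n]_q) L_n - y [n]_q ^ 2 L_{n-1}`.
For `n = 0` this reads `L_1 = x - y`. -/
noncomputable def qLaguerre {R : Type*} [CommRing R] (q y : R) : ℕ → R[X]
  | 0 => 1
  | 1 => X - C y
  | n + 2 =>
      (X - C (y * qInt q (n + 2)) - C (qInt q (n + 1))) * qLaguerre q y (n + 1)
        - C (y * qInt q (n + 1) ^ 2) * qLaguerre q y n

/-- The number of weak excedances of a permutation. -/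
def wex {n : ℕ} (σ : Equiv.Perm (Fin n)) : ℕ :=
  (Finset.univ.filter fun i : Fin n => i ≤ σ i).card

/-- The number of crossings of a permutation. -/
def cr {n : ℕ} (σ : Equiv.Perm (Fin n)) : ℕ :=
  (∑ i : Fin n, (Finset.univ.filter fun j : Fin n => j < i ∧ i ≤ σ j ∧ σ j < σ i).card) +
    ∑ i : Fin n, (Finset.univ.filter fun j : Fin n => j > i ∧ i > σ j ∧ σ j > σ i).card

/-- The moment `μ_n(y, q)`: the enumerating polynomial of the permutations of `n` letters by weak
excedances and crossings. -/
def moment {R : Type*} [CommRing R] (q y : R) (n : ℕ) : R :=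
  ∑ σ : Equiv.Perm (Fin n), y ^ wex σ * q ^ cr σ

/-- The linear functional on polynomials with `x ^ n ↦ μ_n(y, q)`. -/
noncomputable def momentFunctional {R : Type*} [CommRing R] (q y : R) : R[X] →ₗ[R] R :=
  Polynomial.lsum fun n => LinearMap.mulRight R (moment q y n)

theorem momentFunctional_X_pow {R : Type*} [CommRing R] (q y : R) (n : ℕ) :
    momentFunctional q y (X ^ n) = moment q y n := by
  simp [momentFunctional, Polynomial.lsum_apply, ← monomial_one_right_eq_X_pow]

/-- The linearization coefficient `I(n_1, ..., n_k)`: the value of the moment functional at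
`L_{n_1}(x; q) ... L_{n_k}(x; q)`. -/
noncomputable def linCoeff {R : Type*} [CommRing R] (q y : R) (ns : List ℕ) : R :=
  momentFunctional q y (ns.map (qLaguerre q y)).prod

end QLaguerre

/-! Part (i) is a comparison of three-term recurrences: after the affine rescaling the coefficients
agree.

For part (ii), a permutation is a complete rook placement on an `n × n` board. Partial placements
carry weights compatible with adding one row and then one column, so the weighted count `R n h` of
those with `h` free columns satisfies `R (n+1) h = R n (h-1) + b_h R n h + c_{h+1} R n (h+1)` with
`b_h = y[h+1] + [h]` and `c_h = y[h]^2` (`rookSum_succ`). These are the recurrence coefficients of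
`L_h`. Hence the functional sends `x^n L_h` to `y^h h!_q^2 R n h`; taking `n = 0`, it kills every
`L_h` with `h > 0`.

Expanding `x L_n L_m P` in two ways gives a recurrence in `(n, m)` for the value at `L_n L_m P`,
which determines all values from the row `n = 0`. It remains to see that the closed form obeys the
same recurrence (`tripleCoeff_recurrence`). Divided by the `q`-factorials, this is a creative
telescoping argument: a recurrence for the inner sums (`rogersSzego_succ`) and an identity between
`q`-integers (`contiguity`) turn the recurrence, applied to summands, into a difference `Y (s-1) - Y
s`. -/

open Polynomial

namespace QLaguerre

/-! ### `q`-integers and the Al-Salam-Chihara form of the polynomials. -/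

section Basic


variable {R : Type*} [CommRing R]

theorem qInt_zero (q : R) : qInt q 0 = 0 := by simp [qInt]

theorem qInt_succ (q : R) (n : ℕ) : qInt q (n + 1) = qInt q n + q ^ n := by
  simp [qInt, Finset.sum_range_succ]

theorem qInt_mul_sub (q : R) (n : ℕ) : (q - 1) * qInt q n = q ^ n - 1 := by
  rw [qInt, mul_comm, geom_sum_mul]

theorem pow_eq_qInt (q : R) (n : ℕ) : q ^ n = 1 + (q - 1) * qInt q n := by
  rw [qInt_mul_sub]; ring

theorem qInt_add (q : R) (m n : ℕ) : qInt q (m + n) = qInt q m + q ^ m * qInt q n := by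
  simp [qInt, Finset.sum_range_add, Finset.mul_sum, pow_add]

theorem qFact_zero (q : R) : qFact q 0 = 1 := by simp [qFact]

theorem qFact_succ (q : R) (n : ℕ) : qFact q (n + 1) = qFact q n * qInt q (n + 1) := by
  simp [qFact, Finset.prod_range_succ]

/-- One formula covers `n = 0` too: the truncated index `n - 1` is harmless because `[0]_q = 0`. -/
theorem qLaguerre_succ (q y : R) (n : ℕ) :
    qLaguerre q y (n + 1) =
      (X - C (y * qInt q (n + 1) + qInt q n)) * qLaguerre q y n
        - C (y * qInt q n ^ 2) * qLaguerre q y (n - 1) := by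
  cases n with
  | zero => simp [qLaguerre, qInt]
  | succ n =>
    simp only [qLaguerre, Nat.add_sub_cancel, C_add]
    ring

theorem qLaguerre_eq_rescaledAlSalamChihara {K : Type*} [Field K] [CharZero K] {q y r : K}
    (hr : r ≠ 0) (hy : r ^ 2 = y) (hq : q ≠ 1) :
    ∀ n : ℕ, qLaguerre q y n = rescaledAlSalamChihara q y r n
  | 0 => by simp [qLaguerre, rescaledAlSalamChihara, alSalamChihara]
  | 1 => by
    have h1 : q - 1 ≠ 0 := sub_ne_zero.2 hq
    have e : r / (q - 1) * (2 * (1 / (2 * r))) * (q - 1) = 1 := by field_simp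
    have e' : r / (q - 1) * (2 * (1 / (2 * r)) * (y + 1) - (1 / r + r * q)) = -y := by
      subst hy; field_simp; ring
    have e1 := congrArg (C : K → K[X]) e
    have e2 := congrArg (C : K → K[X]) e'
    simp only [C_mul, C_add, C_sub, C_neg, C_1, C_ofNat] at e1 e2
    simp only [qLaguerre, rescaledAlSalamChihara, alSalamChihara, sub_comp, mul_comp, X_comp,
      C_comp, ofNat_comp, pow_one]
    simp only [C_add, C_mul, C_sub, C_1]
    linear_combination (-X) * e1 - e2
  | n + 2 => by
    have h1 : q - 1 ≠ 0 := sub_ne_zero.2 hq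
    have e : r / (q - 1) * (2 * (1 / (2 * r))) * (q - 1) = 1 := by field_simp
    have e' : r / (q - 1) * (2 * (1 / (2 * r)) * (y + 1) - (1 / r + r * q) * q ^ (n + 1)) =
        -(y * qInt q (n + 2)) - qInt q (n + 1) := by
      have a1 := qInt_mul_sub q (n + 1)
      have a2 := qInt_mul_sub q (n + 2)
      apply mul_left_cancel₀ h1
      subst hy; field_simp
      linear_combination r ^ 2 * a2 + a1
    -- Here `αβ = q`, so both factors equal `1 - q ^ (n + 1)` and their product becomes a square of
    -- a `q`-integer.
    have e'' : (r / (q - 1)) ^ 2 * ((1 - q ^ (n + 1)) * (1 - 1 / r * (r * q) * q ^ n)) =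
        y * qInt q (n + 1) ^ 2 := by
      have a1 := qInt_mul_sub q (n + 1)
      have : 1 / r * (r * q) * q ^ n = q ^ (n + 1) := by field_simp; ring
      rw [this]
      subst hy
      have : 1 - q ^ (n + 1) = -((q - 1) * qInt q (n + 1)) := by rw [a1]; ring
      rw [this]; field_simp
    have e1 := congrArg (C : K → K[X]) e
    have e2 := congrArg (C : K → K[X]) e'
    have e3 := congrArg (C : K → K[X]) e''
    rw [qLaguerre, qLaguerre_eq_rescaledAlSalamChihara hr hy hq n,
      qLaguerre_eq_rescaledAlSalamChihara hr hy hq (n + 1)]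
    simp only [rescaledAlSalamChihara]
    rw [alSalamChihara]
    simp only [C_mul, C_add, C_sub, C_neg, C_1, C_ofNat, C_pow] at e1 e2 e3
    simp only [sub_comp, mul_comp, X_comp,
      C_comp, ofNat_comp]
    simp only [C_add, C_mul, C_sub, C_1, C_pow]
    generalize alSalamChihara (1 / r) (r * q) q n = U at *
    generalize alSalamChihara (1 / r) (r * q) q (n + 1) = V at *
    generalize hU : U.comp _ = U' at *
    generalize hV : V.comp _ = V' at *
    linear_combination (-X) * C (r / (q - 1)) ^ (n + 1) * V' * e1
      - C (r / (q - 1)) ^ (n + 1) * V' * e2 + C (r / (q - 1)) ^ n * U' * e3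

end Basic

/-! ### Rook placements on rectangular boards. -/

section Rooks


open Finset

/-- Placements of non-attacking rooks on the board `{0, …, m - 1} × {0, …, n - 1}`. -/
def rooks (m n : ℕ) : Finset (Finset (ℕ × ℕ)) :=
  (range m ×ˢ range n).powerset.filter fun P =>
    Set.InjOn Prod.fst (P : Set (ℕ × ℕ)) ∧ Set.InjOn Prod.snd (P : Set (ℕ × ℕ))

/-- The rows among `0, …, m - 1` containing no rook. -/
def freeRows (m : ℕ) (P : Finset (ℕ × ℕ)) : Finset ℕ := range m \ P.image Prod.fst

/-- The columns among `0, …, n - 1` containing no rook. -/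
def freeCols (n : ℕ) (P : Finset (ℕ × ℕ)) : Finset ℕ := range n \ P.image Prod.snd

theorem mem_rooks {m n : ℕ} {P : Finset (ℕ × ℕ)} :
    P ∈ rooks m n ↔ (∀ p ∈ P, p.1 < m ∧ p.2 < n) ∧
      (∀ p ∈ P, ∀ p' ∈ P, p.1 = p'.1 → p = p') ∧ (∀ p ∈ P, ∀ p' ∈ P, p.2 = p'.2 → p = p') := by
  simp only [rooks, mem_filter, mem_powerset, subset_iff, mem_product, mem_range, Set.InjOn,
    mem_coe]

theorem mem_freeRows {m i : ℕ} {P : Finset (ℕ × ℕ)} :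
    i ∈ freeRows m P ↔ i < m ∧ ∀ p ∈ P, p.1 ≠ i := by
  simp only [freeRows, mem_sdiff, mem_range, mem_image, not_exists, not_and, ne_eq]

theorem mem_freeCols {n i : ℕ} {P : Finset (ℕ × ℕ)} :
    i ∈ freeCols n P ↔ i < n ∧ ∀ p ∈ P, p.2 ≠ i := by
  simp only [freeCols, mem_sdiff, mem_range, mem_image, not_exists, not_and, ne_eq]

theorem card_freeRows_add {m n : ℕ} {P : Finset (ℕ × ℕ)} (hP : P ∈ rooks m n) :
    (freeRows m P).card + P.card = m := by
  rw [mem_rooks] at hP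
  have h1 : (P.image Prod.fst).card = P.card :=
    card_image_of_injOn fun p hp p' hp' e => hP.2.1 p hp p' hp' e
  have h2 : P.image Prod.fst ⊆ range m := by
    intro i hi
    obtain ⟨p, hp, rfl⟩ := mem_image.1 hi
    exact mem_range.2 (hP.1 p hp).1
  rw [freeRows, ← h1, card_sdiff_add_card_eq_card h2, card_range]

theorem card_freeCols_add {m n : ℕ} {P : Finset (ℕ × ℕ)} (hP : P ∈ rooks m n) :
    (freeCols n P).card + P.card = n := by
  rw [mem_rooks] at hP
  have h1 : (P.image Prod.snd).card = P.card :=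
    card_image_of_injOn fun p hp p' hp' e => hP.2.2 p hp p' hp' e
  have h2 : P.image Prod.snd ⊆ range n := by
    intro i hi
    obtain ⟨p, hp, rfl⟩ := mem_image.1 hi
    exact mem_range.2 (hP.1 p hp).2
  rw [freeCols, ← h1, card_sdiff_add_card_eq_card h2, card_range]

variable {M : Type*} [AddCommMonoid M]

/-- A rook placement on a board with one more row has its last row empty or occupied once. -/
theorem sum_rooks_succ_row (m n : ℕ) (g : Finset (ℕ × ℕ) → M) :
    ∑ P ∈ rooks (m + 1) n, g P =
      ∑ P ∈ rooks m n, g P + ∑ P ∈ rooks m n, ∑ b ∈ freeCols n P, g (insert (m, b) P) := by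
  classical
  rw [← sum_filter_not_add_sum_filter (rooks (m + 1) n) (fun P => ∃ p ∈ P, p.1 = m)]
  congr 1
  · refine sum_congr ?_ fun _ _ => rfl
    ext P
    simp only [mem_filter, mem_rooks, not_exists, not_and]
    grind
  · rw [sum_sigma']
    symm
    refine sum_bij (fun (x : Σ _ : Finset (ℕ × ℕ), ℕ) _ => insert (m, x.2) x.1) ?_ ?_ ?_ ?_
    · rintro ⟨P, b⟩ h
      simp only [mem_sigma, mem_rooks, mem_freeCols, mem_filter] at h ⊢
      refine ⟨?_, _, mem_insert_self _ _, rfl⟩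
      grind
    · rintro ⟨P, b⟩ h ⟨P', b'⟩ h' e
      simp only [mem_sigma, mem_rooks, mem_freeCols] at h h' e
      have hP : P = (insert (m, b) P).filter (fun p => p.1 < m) := by
        ext p; simp only [mem_filter, mem_insert]; grind
      have hP' : P' = (insert (m, b') P').filter (fun p => p.1 < m) := by
        ext p; simp only [mem_filter, mem_insert]; grind
      have hPP : P = P' := by rw [hP, hP', e]
      subst hPP
      have : (m, b) ∈ insert (m, b') P := e ▸ mem_insert_self _ _
      grind
    · intro P h
      simp only [mem_rooks, mem_filter] at h
      obtain ⟨⟨h1, h2, h3⟩, ⟨a, b⟩, hp, rfl⟩ := h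
      refine ⟨⟨P.erase (a, b), b⟩, ?_, insert_erase hp⟩
      simp only [mem_sigma, mem_rooks, mem_freeCols, mem_erase]
      grind
    · intros; rfl

/-- A rook placement on a board with one more column has its last column empty or occupied
once. -/
theorem sum_rooks_succ_col (m n : ℕ) (g : Finset (ℕ × ℕ) → M) :
    ∑ P ∈ rooks m (n + 1), g P =
      ∑ P ∈ rooks m n, g P + ∑ P ∈ rooks m n, ∑ a ∈ freeRows m P, g (insert (a, n) P) := by
  classical
  rw [← sum_filter_not_add_sum_filter (rooks m (n + 1)) (fun P => ∃ p ∈ P, p.2 = n)]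
  congr 1
  · refine sum_congr ?_ fun _ _ => rfl
    ext P
    simp only [mem_filter, mem_rooks, not_exists, not_and]
    grind
  · rw [sum_sigma']
    symm
    refine sum_bij (fun (x : Σ _ : Finset (ℕ × ℕ), ℕ) _ => insert (x.2, n) x.1) ?_ ?_ ?_ ?_
    · rintro ⟨P, b⟩ h
      simp only [mem_sigma, mem_rooks, mem_freeRows, mem_filter] at h ⊢
      refine ⟨?_, _, mem_insert_self _ _, rfl⟩
      grind
    · rintro ⟨P, b⟩ h ⟨P', b'⟩ h' e
      simp only [mem_sigma, mem_rooks, mem_freeRows] at h h' e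
      have hP : P = (insert (b, n) P).filter (fun p => p.2 < n) := by
        ext p; simp only [mem_filter, mem_insert]; grind
      have hP' : P' = (insert (b', n) P').filter (fun p => p.2 < n) := by
        ext p; simp only [mem_filter, mem_insert]; grind
      have hPP : P = P' := by rw [hP, hP', e]
      subst hPP
      have : (b, n) ∈ insert (b', n) P := e ▸ mem_insert_self _ _
      grind
    · intro P h
      simp only [mem_rooks, mem_filter] at h
      obtain ⟨⟨h1, h2, h3⟩, ⟨a, b⟩, hp, rfl⟩ := h
      refine ⟨⟨P.erase (a, b), a⟩, ?_, insert_erase hp⟩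
      simp only [mem_sigma, mem_rooks, mem_freeRows, mem_erase]
      grind
    · intros; rfl

end Rooks

/-! ### Moments as weighted rook placements, and orthogonality. -/

section Moments


open Finset

variable {R : Type*} [CommRing R]

/-- The weight of a single rook in a placement: a rook `(a, b)` with `a ≤ b` contributes `y` and
a factor `q` for each row in `(a, b]` not occupied up to column `b`; a rook with `b < a` contributes
a factor `q` for each column in `(b, a)` not occupied up to row `a`. -/
def rookWeight (q y : R) (P : Finset (ℕ × ℕ)) (p : ℕ × ℕ) : R :=
  if p.1 ≤ p.2 then
    y * q ^ ((Ioc p.1 p.2).filter fun i => ∀ p' ∈ P, p'.1 = i → p.2 < p'.2).card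
  else q ^ ((Ioo p.2 p.1).filter fun j => ∀ p' ∈ P, p'.2 = j → p.1 < p'.1).card

/-- The weight of a rook placement. -/
def placementWeight (q y : R) (P : Finset (ℕ × ℕ)) : R := ∏ p ∈ P, rookWeight q y P p

/-- Old weights do not change: the new row lies beyond the rows seen by a rook with `a ≤ b`, and for
the other rooks a column filled in a later row still counts as unoccupied. The new rook lies
strictly below the diagonal and sees the free columns to its right. -/
theorem placementWeight_insert_row (q y : R) {n b : ℕ} {P : Finset (ℕ × ℕ)}
    (hP : P ∈ rooks n n) (hb : b ∈ freeCols n P) :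
    placementWeight q y (insert (n, b) P) =
      placementWeight q y P * q ^ ((freeCols n P).filter (b < ·)).card := by
  rw [mem_rooks] at hP
  rw [mem_freeCols] at hb
  have hn : (n, b) ∉ P := fun h => absurd (hP.1 _ h).1 (lt_irrefl _)
  rw [placementWeight, prod_insert hn, mul_comm, placementWeight]
  congr 1
  · refine prod_congr rfl fun p hp => ?_
    have := hP.1 p hp
    simp only [rookWeight, forall_mem_insert]
    congr 3
    · refine congrArg card (filter_congr fun i hi => ?_)
      rw [mem_Ioc] at hi
      grind
    · refine filter_congr fun i hi => ?_
      grind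
  · rw [rookWeight, if_neg (by simpa using hb.1)]
    congr 2
    ext j
    simp only [mem_filter, mem_Ioo, mem_freeCols, forall_mem_insert]
    grind

/-- The column is added after the row, so the corner `(n, n)` is filled at this stage and receives
the factor `y` of a weak excedance. -/
theorem placementWeight_insert_col (q y : R) {n a : ℕ} {P : Finset (ℕ × ℕ)}
    (hP : P ∈ rooks (n + 1) n) (ha : a ∈ freeRows (n + 1) P) :
    placementWeight q y (insert (a, n) P) =
      placementWeight q y P * (y * q ^ ((freeRows (n + 1) P).filter (a < ·)).card) := by
  rw [mem_rooks] at hP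
  rw [mem_freeRows] at ha
  have hn : (a, n) ∉ P := fun h => absurd (hP.1 _ h).2 (lt_irrefl _)
  rw [placementWeight, prod_insert hn, mul_comm, placementWeight]
  congr 1
  · refine prod_congr rfl fun p hp => ?_
    have := hP.1 p hp
    simp only [rookWeight, forall_mem_insert]
    congr 3
    · refine congrArg card (filter_congr fun i hi => ?_)
      rw [mem_Ioc] at hi
      grind
    · refine filter_congr fun i hi => ?_
      rw [mem_Ioo] at hi
      grind
  · rw [rookWeight, if_pos (by simpa using Nat.lt_succ_iff.1 ha.1)]
    congr 3
    ext j
    simp only [mem_filter, mem_Ioc, mem_freeRows, forall_mem_insert]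
    grind

/-- Counted from the largest element down, the exponents are `0, 1, …, s.card - 1`. This turns the
choice of a free row or column into a `q`-integer. -/
theorem sum_pow_card_filter_lt (q : R) (s : Finset ℕ) :
    ∑ a ∈ s, q ^ (s.filter (a < ·)).card = qInt q s.card := by
  induction s using Finset.induction_on_min with
  | empty => simp [qInt]
  | insert a s h ih =>
    have ha : a ∉ s := fun h' => lt_irrefl _ (h a h')
    rw [sum_insert ha, card_insert_of_notMem ha, qInt_succ, ← ih, add_comm]
    congr 1
    · refine sum_congr rfl fun b hb => ?_
      rw [filter_insert, if_neg (h b hb).le.not_gt]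
    · rw [filter_insert, if_neg (lt_irrefl _), filter_true_of_mem h]

/-- The weighted sum of the rook placements on an `m × n` board leaving `h` columns free. -/
def rookSum (q y : R) (m n h : ℕ) : R :=
  ∑ P ∈ rooks m n, if P.card + h = n then placementWeight q y P else 0

theorem rookSum_succ_row (q y : R) (n h : ℕ) :
    rookSum q y (n + 1) n h =
      rookSum q y n n h + qInt q (h + 1) * rookSum q y n n (h + 1) := by
  rw [rookSum, sum_rooks_succ_row, rookSum, rookSum, mul_sum]
  congr 1
  refine sum_congr rfl fun P hP => ?_
  have hc := card_freeCols_add hP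
  by_cases e : P.card + (h + 1) = n
  · rw [if_pos e, show h + 1 = (freeCols n P).card by omega, ← sum_pow_card_filter_lt, sum_mul]
    refine sum_congr rfl fun b hb => ?_
    have hn : (n, b) ∉ P := fun h => absurd ((mem_rooks.1 hP).1 _ h).1 (lt_irrefl _)
    rw [card_insert_of_notMem hn, if_pos (by omega), placementWeight_insert_row q y hP hb, mul_comm]
  · rw [if_neg e, mul_zero]
    refine sum_eq_zero fun b hb => ?_
    have hn : (n, b) ∉ P := fun h => absurd ((mem_rooks.1 hP).1 _ h).1 (lt_irrefl _)
    rw [card_insert_of_notMem hn, if_neg (by omega)]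

/-- On an `(n + 1) × n` board, `h` free columns mean `h + 1` free rows, whence `[h + 1]_q`. -/
theorem rookSum_succ_col (q y : R) (n h : ℕ) :
    rookSum q y (n + 1) (n + 1) h =
      (if h = 0 then 0 else rookSum q y (n + 1) n (h - 1)) +
        y * qInt q (h + 1) * rookSum q y (n + 1) n h := by
  rw [rookSum, sum_rooks_succ_col, rookSum, rookSum, mul_sum]
  congr 1
  · split_ifs with h0
    · refine sum_eq_zero fun P hP => ?_
      have hc := card_freeCols_add hP
      rw [if_neg (by omega)]
    · refine sum_congr rfl fun P hP => ?_
      congr 1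
      exact propext (by omega)
  refine sum_congr rfl fun P hP => ?_
  have hc := card_freeRows_add hP
  by_cases e : P.card + h = n
  · rw [if_pos e, show h + 1 = (freeRows (n + 1) P).card by omega, ← sum_pow_card_filter_lt,
      mul_sum, sum_mul]
    refine sum_congr rfl fun a ha => ?_
    have hn : (a, n) ∉ P := fun h => absurd ((mem_rooks.1 hP).1 _ h).2 (lt_irrefl _)
    rw [card_insert_of_notMem hn, if_pos (by omega), placementWeight_insert_col q y hP ha, mul_comm]
  · rw [if_neg e, mul_zero]
    refine sum_eq_zero fun a ha => ?_
    have hn : (a, n) ∉ P := fun h => absurd ((mem_rooks.1 hP).1 _ h).2 (lt_irrefl _)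
    rw [card_insert_of_notMem hn, if_neg (by omega)]

theorem rookSum_zero (q y : R) (h : ℕ) : rookSum q y 0 0 h = if h = 0 then 1 else 0 := by
  have : rooks 0 0 = {∅} := by
    ext P
    simp only [mem_rooks, mem_singleton, not_lt_zero, false_and, eq_empty_iff_forall_notMem]
    grind
  simp [rookSum, this, placementWeight]

/-- The moments as a sum over complete rook placements. -/
theorem moment_eq_rookSum (q y : R) (n : ℕ) : moment q y n = rookSum q y n n 0 := by
  rw [rookSum, ← sum_filter, moment]
  refine sum_bij
    (fun (σ : Equiv.Perm (Fin n)) _ => univ.image fun i : Fin n => ((i : ℕ), (σ i : ℕ)))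
    ?_ ?_ ?_ ?_
  · intro σ _
    have hinj : Function.Injective fun i : Fin n => ((i : ℕ), (σ i : ℕ)) := fun i j h =>
      Fin.ext (Prod.ext_iff.1 h).1
    rw [mem_filter, card_image_of_injective _ hinj, mem_rooks]
    simp only [mem_image, mem_univ, true_and, forall_exists_index, forall_apply_eq_imp_iff,
      Fin.is_lt, and_self, implies_true, card_univ, Fintype.card_fin, add_zero, and_true]
    refine ⟨fun i j h => ?_, fun i j h => ?_⟩
    · rw [Fin.ext h]
    · rw [σ.injective (Fin.ext h)]
  · intro σ _ τ _ h
    ext i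
    have : ((i : ℕ), (σ i : ℕ)) ∈ univ.image fun i : Fin n => ((i : ℕ), (τ i : ℕ)) := by
      rw [← h]; exact mem_image_of_mem _ (mem_univ _)
    obtain ⟨j, -, hj⟩ := mem_image.1 this
    rw [Prod.ext_iff] at hj
    obtain rfl : j = i := Fin.ext hj.1
    exact hj.2.symm
  · intro P hP
    rw [mem_filter] at hP
    have hc := card_freeRows_add hP.1
    have hfree : freeRows n P = ∅ := card_eq_zero.1 (by omega)
    have hR := mem_rooks.1 hP.1
    have hex : ∀ i : Fin n, ∃ b : Fin n, ((i : ℕ), (b : ℕ)) ∈ P := by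
      intro i
      have hi : (i : ℕ) ∉ freeRows n P := by rw [hfree]; simp
      rw [mem_freeRows] at hi
      push Not at hi
      obtain ⟨⟨a, b⟩, hp, rfl⟩ := hi i.2
      exact ⟨⟨b, (hR.1 _ hp).2⟩, hp⟩
    choose f hf using hex
    have hinj : Function.Injective f := by
      intro i j h
      have := hR.2.2 _ (hf i) _ (hf j) (by rw [h])
      exact Fin.ext (Prod.ext_iff.1 this).1
    refine ⟨Equiv.ofBijective f (Finite.injective_iff_bijective.1 hinj), mem_univ _, ?_⟩
    ext p
    simp only [mem_image, mem_univ, true_and, Equiv.ofBijective_apply]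
    constructor
    · rintro ⟨i, rfl⟩
      exact hf i
    · intro hp
      refine ⟨⟨p.1, (hR.1 p hp).1⟩, ?_⟩
      exact hR.2.1 _ (hf _) _ hp rfl
  · intro σ _
    have hinj : Function.Injective fun i : Fin n => ((i : ℕ), (σ i : ℕ)) := fun i j h =>
      Fin.ext (Prod.ext_iff.1 h).1
    -- In `cr` a crossing of the first kind is charged to its larger index, in `rookWeight` to its
    -- smaller one; double counting moves it.
    have hcr : cr σ = ∑ i : Fin n, ((univ.filter fun j : Fin n => i < j ∧ j ≤ σ i ∧ σ i < σ j).card +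
        (univ.filter fun j : Fin n => j > i ∧ i > σ j ∧ σ j > σ i).card) := by
      rw [cr, sum_add_distrib]
      congr 1
      exact sum_card_bipartiteAbove_eq_sum_card_bipartiteBelow
        (fun i j : Fin n => j < i ∧ i ≤ σ j ∧ σ j < σ i)
    rw [hcr, ← prod_pow_eq_pow_sum, wex, ← prod_const, prod_filter, ← prod_mul_distrib,
      placementWeight, prod_image fun i _ j _ h => hinj h]
    refine prod_congr rfl fun i _ => ?_
    rw [rookWeight]
    simp only [mem_image, mem_univ, true_and, forall_exists_index, forall_apply_eq_imp_iff,
      Fin.val_fin_le, Fin.val_fin_lt]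
    split_ifs with hi
    · congr 2
      have he : (univ.filter fun j : Fin n => j > i ∧ i > σ j ∧ σ j > σ i) = ∅ :=
        filter_eq_empty_iff.2 fun j _ h => (lt_of_lt_of_le h.2.1 hi).not_gt h.2.2
      rw [he, card_empty, add_zero]
      refine (card_nbij (fun j : Fin n => (j : ℕ)) ?_ (fun a _ b _ h => Fin.ext h) ?_)
      · intro j hj
        simp only [mem_coe, mem_filter, mem_univ, true_and, mem_Ioc] at hj ⊢
        refine ⟨⟨hj.1, hj.2.1⟩, fun a ha => ?_⟩
        rw [Fin.ext ha]
        exact hj.2.2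
      · intro j hj
        simp only [mem_coe, mem_filter, mem_Ioc] at hj
        refine ⟨⟨j, by omega⟩, ?_, rfl⟩
        simp only [mem_coe, mem_filter, mem_univ, true_and]
        exact ⟨hj.1.1, hj.1.2, hj.2 _ rfl⟩
    · rw [one_mul]
      congr 1
      have he : (univ.filter fun j : Fin n => i < j ∧ j ≤ σ i ∧ σ i < σ j) = ∅ :=
        filter_eq_empty_iff.2 fun j _ h => hi (h.1.le.trans h.2.1)
      rw [he, card_empty, zero_add]
      refine (card_nbij (fun j : Fin n => (σ j : ℕ)) ?_
        (fun a _ b _ h => σ.injective (Fin.ext h)) ?_)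
      · intro j hj
        simp only [mem_coe, mem_filter, mem_univ, true_and, mem_Ioo] at hj ⊢
        refine ⟨⟨hj.2.2, hj.2.1⟩, fun a ha => ?_⟩
        rw [σ.injective (Fin.ext ha)]
        exact hj.1
      · intro j hj
        simp only [mem_coe, mem_filter, mem_Ioo] at hj
        refine ⟨σ.symm ⟨j, by omega⟩, ?_, by simp⟩
        simp only [mem_coe, mem_filter, mem_univ, true_and, Equiv.apply_symm_apply]
        exact ⟨hj.2 _ (by simp), hj.1.2, hj.1.1⟩

theorem rookSum_succ (q y : R) (n h : ℕ) :
    rookSum q y (n + 1) (n + 1) h =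
      (if h = 0 then 0 else rookSum q y n n (h - 1)) +
        (y * qInt q (h + 1) + qInt q h) * rookSum q y n n h +
        y * qInt q (h + 1) ^ 2 * rookSum q y n n (h + 1) := by
  rw [rookSum_succ_col]
  cases h with
  | zero => simp only [rookSum_succ_row, if_true, qInt_zero]; ring
  | succ h =>
    simp only [rookSum_succ_row, if_neg (Nat.succ_ne_zero h), Nat.add_sub_cancel]; ring

/-- The polynomials `L_h` are orthogonal to lower powers for the moment functional. -/
theorem momentFunctional_X_pow_mul_qLaguerre (q y : R) (h : ℕ) :
    ∀ n, momentFunctional q y (X ^ n * qLaguerre q y h) =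
      y ^ h * qFact q h ^ 2 * rookSum q y n n h := by
  induction h using Nat.strong_induction_on with
  | _ h ih =>
    intro n
    cases h with
    | zero => simp [qLaguerre, momentFunctional_X_pow, qFact_zero, moment_eq_rookSum]
    | succ h =>
      have e : X ^ n * qLaguerre q y (h + 1) = X ^ (n + 1) * qLaguerre q y h
          - (y * qInt q (h + 1) + qInt q h) • (X ^ n * qLaguerre q y h)
          - (y * qInt q h ^ 2) • (X ^ n * qLaguerre q y (h - 1)) := by
        rw [qLaguerre_succ, smul_eq_C_mul, smul_eq_C_mul]; ring
      rw [e, map_sub, map_sub, map_smul, map_smul, ih h (by omega), ih h (by omega),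
        ih (h - 1) (by omega), rookSum_succ, smul_eq_mul, smul_eq_mul, qFact_succ]
      cases h with
      | zero => simp only [qInt_zero, if_true]; ring
      | succ h =>
        simp only [if_neg (Nat.succ_ne_zero h), Nat.add_sub_cancel, qFact_succ]; ring

theorem momentFunctional_qLaguerre (q y : R) (h : ℕ) :
    momentFunctional q y (qLaguerre q y h) = if h = 0 then 1 else 0 := by
  have := momentFunctional_X_pow_mul_qLaguerre q y h 0
  rw [pow_zero, one_mul, rookSum_zero] at this
  rw [this]
  split_ifs with h0
  · simp [h0, qFact_zero]
  · simp

end Moments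

/-! ### The linearization recurrence, and the recurrence of the inner sums. -/

section Recurrence


open Finset

/-- A family with the symmetric recurrence of `I(n, m)` is determined by its row `n = 0`. -/
theorem eq_of_linearization_recurrence {R : Type*} [CommRing R] (b c : ℕ → R) {f g : ℕ → ℕ → R}
    (hf : ∀ n m, f (n + 1) m =
      f n (m + 1) + (b m - b n) * f n m + c m * f n (m - 1) - c n * f (n - 1) m)
    (hg : ∀ n m, g (n + 1) m =
      g n (m + 1) + (b m - b n) * g n m + c m * g n (m - 1) - c n * g (n - 1) m)
    (h0 : ∀ m, f 0 m = g 0 m) (n m : ℕ) : f n m = g n m := by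
  induction n using Nat.strong_induction_on generalizing m with
  | _ n ih =>
    cases n with
    | zero => exact h0 m
    | succ n => rw [hf, hg]; simp only [ih n (by omega), ih (n - 1) (by omega)]

/-- The value of the moment functional at `L_n L_m P` obeys the linearization recurrence. -/
theorem momentFunctional_recurrence {R : Type*} [CommRing R] (q y : R) (P : R[X]) (n m : ℕ) :
    momentFunctional q y (qLaguerre q y (n + 1) * (qLaguerre q y m * P)) =
      momentFunctional q y (qLaguerre q y n * (qLaguerre q y (m + 1) * P))
      + ((y * qInt q (m + 1) + qInt q m) - (y * qInt q (n + 1) + qInt q n)) *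
        momentFunctional q y (qLaguerre q y n * (qLaguerre q y m * P))
      + y * qInt q m ^ 2 * momentFunctional q y (qLaguerre q y n * (qLaguerre q y (m - 1) * P))
      - y * qInt q n ^ 2 *
        momentFunctional q y (qLaguerre q y (n - 1) * (qLaguerre q y m * P)) := by
  have e : qLaguerre q y (n + 1) * (qLaguerre q y m * P) =
      qLaguerre q y n * (qLaguerre q y (m + 1) * P)
      + ((y * qInt q (m + 1) + qInt q m) - (y * qInt q (n + 1) + qInt q n)) •
        (qLaguerre q y n * (qLaguerre q y m * P))
      + (y * qInt q m ^ 2) • (qLaguerre q y n * (qLaguerre q y (m - 1) * P))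
      - (y * qInt q n ^ 2) • (qLaguerre q y (n - 1) * (qLaguerre q y m * P)) := by
    rw [qLaguerre_succ, qLaguerre_succ q y m]
    simp only [smul_eq_C_mul, C_sub, C_add, C_mul]
    ring
  rw [e]
  simp only [map_add, map_sub, map_smul, smul_eq_mul]

variable {K : Type*} [Field K]

/-- The normalized polynomial `p_t / t!_q`, where
`p_t = ∑_k [t choose k]_q y ^ k q ^ ((k + 1 choose 2) + (t - k choose 2))`. -/
def rogersSzego (q y : K) (t : ℕ) : K :=
  ∑ p ∈ antidiagonal t,
    (y ^ p.1 * q ^ (p.1 + 1).choose 2 / qFact q p.1) * (q ^ p.2.choose 2 / qFact q p.2)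

theorem qFact_ne_zero {q : K} (hq : ∀ m : ℕ, 0 < m → qInt q m ≠ 0) (n : ℕ) : qFact q n ≠ 0 :=
  prod_ne_zero_iff.2 fun i _ => hq _ i.succ_pos

theorem sum_qBinom_eq_rogersSzego {q : K} (hq : ∀ m : ℕ, 0 < m → qInt q m ≠ 0)
    (y : K) (t : ℕ) :
    ∑ k ∈ range (t + 1), qBinom q t k * y ^ k * q ^ ((k + 1).choose 2 + (t - k).choose 2) =
      qFact q t * rogersSzego q y t := by
  rw [rogersSzego, Nat.sum_antidiagonal_eq_sum_range_succ_mk, mul_sum]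
  refine sum_congr rfl fun k hk => ?_
  have h1 := qFact_ne_zero hq k
  have h2 := qFact_ne_zero hq (t - k)
  rw [qBinom, if_pos (Nat.lt_succ_iff.1 (mem_range.1 hk)), pow_add]
  field_simp

/-- The sum is a convolution of `u` and `v`, each with a first-order recurrence. Split `[k + i] =
[i] + q^i [k]` and shift an index in each part; the leftover `q^i` is rewritten by `1 = q^k + (1 -
q)[k]`, and the last term is shifted once more. -/
theorem rogersSzego_succ {q : K} (hq : ∀ m : ℕ, 0 < m → qInt q m ≠ 0)
    (y : K) (t : ℕ) :
    qInt q (t + 1) * rogersSzego q y (t + 1) =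
      q ^ t * (1 + y * q) * rogersSzego q y t +
        (if t = 0 then 0 else (1 - q) * y * q ^ t * rogersSzego q y (t - 1)) := by
  set u : ℕ → K := fun k => y ^ k * q ^ (k + 1).choose 2 / qFact q k with hu
  set v : ℕ → K := fun i => q ^ i.choose 2 / qFact q i with hv
  have hr : ∀ t, rogersSzego q y t = ∑ p ∈ antidiagonal t, u p.1 * v p.2 := fun t => rfl
  have u_succ : ∀ k, qInt q (k + 1) * u (k + 1) = y * q ^ (k + 1) * u k := by
    intro k
    have h1 := qFact_ne_zero hq k
    have h2 := hq _ k.succ_pos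
    simp only [hu, qFact_succ]
    rw [show (k + 1 + 1).choose 2 = (k + 1) + (k + 1).choose 2 by
      rw [Nat.choose_succ_succ' (k + 1) 1, Nat.choose_one_right], pow_add]
    field_simp
    ring
  have v_succ : ∀ i, qInt q (i + 1) * v (i + 1) = q ^ i * v i := by
    intro k
    have h1 := qFact_ne_zero hq k
    have h2 := hq _ k.succ_pos
    simp only [hv, qFact_succ]
    rw [show (k + 1).choose 2 = k + k.choose 2 by
      rw [Nat.choose_succ_succ' k 1, Nat.choose_one_right], pow_add]
    field_simp
  have hU : ∀ t, ∑ p ∈ antidiagonal (t + 1), q ^ p.2 * (qInt q p.1 * u p.1) * v p.2 =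
      y * q ^ (t + 1) * rogersSzego q y t := by
    intro t
    rw [Nat.sum_antidiagonal_succ, hr, mul_sum]
    simp only [qInt_zero, zero_mul, mul_zero, zero_add]
    refine sum_congr rfl fun p hp => ?_
    rw [HasAntidiagonal.mem_antidiagonal] at hp
    rw [u_succ, ← hp]; ring
  have hV : ∀ t, ∑ p ∈ antidiagonal (t + 1), u p.1 * (qInt q p.2 * v p.2) =
      ∑ p ∈ antidiagonal t, q ^ p.2 * u p.1 * v p.2 := by
    intro t
    rw [Nat.sum_antidiagonal_succ']
    simp only [qInt_zero, zero_mul, mul_zero, zero_add]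
    refine sum_congr rfl fun p hp => ?_
    rw [v_succ]; ring
  have hW : ∑ p ∈ antidiagonal t, q ^ p.2 * u p.1 * v p.2 =
      q ^ t * rogersSzego q y t +
        (1 - q) * ∑ p ∈ antidiagonal t, q ^ p.2 * (qInt q p.1 * u p.1) * v p.2 := by
    rw [hr, mul_sum, mul_sum, ← sum_add_distrib]
    refine sum_congr rfl fun p hp => ?_
    rw [HasAntidiagonal.mem_antidiagonal] at hp
    rw [← hp, pow_add]
    linear_combination q ^ p.2 * u p.1 * v p.2 * (-pow_eq_qInt q p.1)
  have hS : qInt q (t + 1) * rogersSzego q y (t + 1) =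
      ∑ p ∈ antidiagonal (t + 1), u p.1 * (qInt q p.2 * v p.2) +
        ∑ p ∈ antidiagonal (t + 1), q ^ p.2 * (qInt q p.1 * u p.1) * v p.2 := by
    rw [hr, mul_sum, ← sum_add_distrib]
    refine sum_congr rfl fun p hp => ?_
    rw [HasAntidiagonal.mem_antidiagonal] at hp
    rw [← hp, add_comm p.1, qInt_add]; ring
  rw [hS, hU, hV, hW]
  cases t with
  | zero => simp [qInt_zero]; ring
  | succ t => rw [hU, if_neg t.succ_ne_zero, Nat.add_sub_cancel]; ring

end Recurrence

/-! ### The closed form and its telescoping recurrence. -/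

section Triple


open Finset

variable {K : Type*} [Field K]

/-- The inverse `q`-factorial `1 / m!_q`, extended by zero to negative integers. -/
def invQFact (q : K) (m : ℤ) : K := if 0 ≤ m then (qFact q m.toNat)⁻¹ else 0

/-- `rogersSzego` extended by zero to negative indices. -/
def rogersSzegoInt (q y : K) (m : ℤ) : K := if 0 ≤ m then rogersSzego q y m.toNat else 0

/-- The factor `s!_q y ^ s`, extended by zero to negative indices. -/
def topFactor (q y : K) (s : ℤ) : K := if 0 ≤ s then qFact q s.toNat * y ^ s.toNat else 0

/-- The truncated sum for `I(n₁, n₂, n₃) / (n₁!_q n₂!_q n₃!_q)`. -/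
def tripleSum (q y : K) (M : ℕ) (n₁ n₂ n₃ : ℤ) : K :=
  ∑ s ∈ range M, topFactor q y s * rogersSzegoInt q y (n₁ + n₂ + n₃ - 2 * s) *
    invQFact q (s - n₁) * invQFact q (s - n₂) * invQFact q (s - n₃)

theorem invQFact_of_neg (q : K) {m : ℤ} (h : m < 0) : invQFact q m = 0 := if_neg h.not_ge

theorem rogersSzegoInt_of_neg (q y : K) {m : ℤ} (h : m < 0) : rogersSzegoInt q y m = 0 :=
  if_neg h.not_ge

/-- Valid for all integers: for `m ≤ 0` both sides vanish, since `m.toNat = 0` and `[0]_q = 0`.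
Boundary terms of the sums thus need no separate treatment. -/
theorem invQFact_sub_one {q : K} (hq : ∀ m : ℕ, 0 < m → qInt q m ≠ 0) (m : ℤ) :
    invQFact q (m - 1) = qInt q m.toNat * invQFact q m := by
  rcases lt_trichotomy m 0 with h | rfl | h
  · rw [invQFact_of_neg q h, invQFact_of_neg q (by omega), mul_zero]
  · simp [qInt_zero, invQFact_of_neg]
  · obtain ⟨n, rfl⟩ : ∃ n : ℕ, m = n + 1 := ⟨(m - 1).toNat, by omega⟩
    have h1 := qFact_ne_zero hq n
    have h2 := hq _ n.succ_pos
    rw [invQFact, if_pos (by omega), invQFact, if_pos (by omega), add_sub_cancel_right,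
      Int.toNat_natCast, show ((n : ℤ) + 1).toNat = n + 1 by omega, qFact_succ]
    field_simp

theorem topFactor_succ (q y : K) (s : ℕ) :
    topFactor q y (s + 1 : ℤ) = qInt q (s + 1) * y * topFactor q y s := by
  rw [topFactor, if_pos (by omega), topFactor, if_pos (by omega), Int.toNat_natCast,
    show ((s : ℤ) + 1).toNat = s + 1 by omega, qFact_succ, pow_succ]
  ring

/-- The algebraic identity behind the linearization recurrence. -/
theorem qInt_linearization_identity (q : K) (a b d : ℕ) :
    qInt q (a + b + d) * (qInt q a - qInt q b)
      - qInt q a * qInt q b * (qInt q b - qInt q a) * (1 - q) * q ^ d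
      + qInt q (b + d) * qInt q b - qInt q (a + d) * qInt q a = 0 := by
  rw [show a + b + d = d + (a + b) by ring, add_comm b d, add_comm a d, qInt_add q d (a + b),
    qInt_add q a b, qInt_add q d b, qInt_add q d a, pow_eq_qInt q a]
  ring

theorem qInt_mul_sub_pred (q : K) (a b : ℕ) :
    qInt q a * qInt q b * (q * (qInt q (b - 1) - qInt q (a - 1))) =
      qInt q a * qInt q b * (qInt q b - qInt q a) := by
  cases a with
  | zero => simp [qInt_zero]
  | succ a =>
    cases b with
    | zero => simp [qInt_zero]
    | succ b =>
      rw [Nat.add_sub_cancel, Nat.add_sub_cancel, add_comm b, add_comm a, qInt_add q 1 b,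
        qInt_add q 1 a]
      simp only [pow_one]
      ring

/-- Six-term contiguity relation for the summands, in terms of `a = s - n₁`, `b = s - n₂`,
`c = s - n₃` and `t = n₁ + n₂ + n₃ + 1 - 2 s`. -/
theorem contiguity {q : K} (hq : ∀ m : ℕ, 0 < m → qInt q m ≠ 0) (y : K) {n₁ n₂ a b c t u : ℤ}
    (h₁ : n₁ + 1 = b + c + t) (h₂ : n₂ + 1 = a + c + t) (hu : u + 1 = a + b + c + t) (ht : 0 ≤ t)
    (h₁' : 0 ≤ n₁) (h₂' : 0 ≤ n₂) :
    qInt q (n₁ + 1).toNat * (topFactor q y u * invQFact q (a - 1) * invQFact q b * invQFact q c)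
    - qInt q (n₂ + 1).toNat * (topFactor q y u * invQFact q a * invQFact q (b - 1) * invQFact q c)
    + topFactor q y u * invQFact q a * invQFact q b * invQFact q c *
        (q ^ c.toNat * (qInt q b.toNat - qInt q a.toNat) * qInt q t.toNat)
    - topFactor q y (u - 1) * invQFact q (a - 1) * invQFact q (b - 1) * invQFact q (c - 1) *
        (q ^ (c - 1).toNat * (qInt q (b - 1).toNat - qInt q (a - 1).toNat) *
          ((1 - q) * y * q ^ (t + 1).toNat))
    + y * qInt q n₁.toNat *
        (topFactor q y (u - 1) * invQFact q a * invQFact q (b - 1) * invQFact q (c - 1))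
    - y * qInt q n₂.toNat *
        (topFactor q y (u - 1) * invQFact q (a - 1) * invQFact q b * invQFact q (c - 1)) = 0 := by
  simp only [invQFact_sub_one hq]
  rcases lt_or_ge a 0 with ha | ha
  · simp [invQFact_of_neg q ha]
  rcases lt_or_ge b 0 with hb | hb
  · simp [invQFact_of_neg q hb]
  rcases lt_or_ge c 0 with hc | hc
  · simp [invQFact_of_neg q hc]
  lift a to ℕ using ha
  lift b to ℕ using hb
  lift c to ℕ using hc
  lift t to ℕ using ht
  generalize invQFact q a = A
  generalize invQFact q b = B
  generalize invQFact q c = C'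
  rw [show (n₁ + 1).toNat = b + c + t by omega, show (n₂ + 1).toNat = a + c + t by omega,
    show n₁.toNat = b + c + t - 1 by omega, show n₂.toNat = a + c + t - 1 by omega,
    show ((t : ℤ) + 1).toNat = t + 1 by omega, show ((c : ℤ) - 1).toNat = c - 1 by omega,
    show ((b : ℤ) - 1).toNat = b - 1 by omega, show ((a : ℤ) - 1).toNat = a - 1 by omega]
  simp only [Int.toNat_natCast]
  -- The three terms with `topFactor q y u` combine to a multiple of `[c]`, a factor that the other
  -- three terms already carry.
  have e1 : qInt q (b + c + t) * qInt q a - qInt q (a + c + t) * qInt q b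
      + q ^ c * (qInt q b - qInt q a) * qInt q t = qInt q c * (qInt q a - qInt q b) := by
    rw [show b + c + t = c + (b + t) by ring, show a + c + t = c + (a + t) by ring, qInt_add q c,
      qInt_add q c, qInt_add q b, qInt_add q a, pow_eq_qInt q a, pow_eq_qInt q b]
    ring
  cases c with
  | zero =>
    simp only [qInt_zero] at e1 ⊢
    linear_combination topFactor q y u * A * B * C' * e1
  | succ c =>
    obtain ⟨u, rfl⟩ : ∃ v : ℕ, u = v := ⟨u.toNat, by omega⟩
    cases u with
    | zero =>
      have ha : a = 0 := by omega
      have hb : b = 0 := by omega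
      subst ha hb
      simp [qInt_zero]
    | succ u =>
      have e2 := qInt_linearization_identity q a b (c + t)
      have e3 := qInt_mul_sub_pred q a b
      have h3 : a + b + (c + t) = u + 1 := by omega
      rw [h3] at e2
      have h4 := topFactor_succ q y u
      rw [Nat.cast_succ, add_sub_cancel_right, h4, show b + (c + 1) + t - 1 = b + (c + t) by omega,
        show a + (c + 1) + t - 1 = a + (c + t) by omega, Nat.add_sub_cancel]
      set T := topFactor q y u
      linear_combination (qInt q (u + 1) * y * T * A * B * C') * e1
        -- After `topFactor_succ` all terms share the factor `y T A B C' [c + 1]`, and `e2` cancels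
        -- them; `e3` removes the predecessors `a - 1` and `b - 1`.
        + (y * T * A * B * C' * qInt q (c + 1)) * e2
        - (y * T * A * B * C' * qInt q (c + 1) * (1 - q) * q ^ (c + t)) * e3

theorem sum_range_int_shift {f : ℤ → K} {M : ℕ} (h0 : f (-1) = 0) (hM : f M = 0) :
    ∑ s ∈ range (M + 1), f s = ∑ s ∈ range (M + 1), f (s - 1) := by
  rw [sum_range_succ, sum_range_succ', hM]
  simp [h0]

theorem rogersSzegoInt_recurrence {q : K} (hq : ∀ m : ℕ, 0 < m → qInt q m ≠ 0) (y : K) {t : ℤ}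
    (ht : 0 ≤ t) :
    q ^ t.toNat * (1 + y * q) * rogersSzegoInt q y t =
      qInt q (t + 1).toNat * rogersSzegoInt q y (t + 1) -
        (1 - q) * y * q ^ t.toNat * rogersSzegoInt q y (t - 1) := by
  lift t to ℕ using ht
  have h := rogersSzego_succ hq y t
  rw [rogersSzegoInt, if_pos (by omega), rogersSzegoInt, if_pos (by omega),
    show ((t : ℤ) + 1).toNat = t + 1 by omega, h, Int.toNat_natCast]
  cases t with
  | zero => simp [rogersSzegoInt]
  | succ t =>
    rw [if_neg t.succ_ne_zero, rogersSzegoInt, if_pos (by omega), Nat.add_sub_cancel,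
      show (((t + 1 : ℕ) : ℤ) - 1).toNat = t by omega]
    ring

theorem tripleSum_recurrence {q : K} (hq : ∀ m : ℕ, 0 < m → qInt q m ≠ 0) (y : K) {M : ℕ}
    {n₁ n₂ n₃ : ℤ} (h₁ : 0 ≤ n₁) (h₂ : 0 ≤ n₂) (hM : n₁ + n₂ + n₃ < M) :
    qInt q (n₁ + 1).toNat * tripleSum q y (M + 1) (n₁ + 1) n₂ n₃
      - qInt q (n₂ + 1).toNat * tripleSum q y (M + 1) n₁ (n₂ + 1) n₃
      + (qInt q n₁.toNat - qInt q n₂.toNat) * (1 + y * q) * tripleSum q y (M + 1) n₁ n₂ n₃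
      + y * qInt q n₁.toNat * tripleSum q y (M + 1) (n₁ - 1) n₂ n₃
      - y * qInt q n₂.toNat * tripleSum q y (M + 1) n₁ (n₂ - 1) n₃ = 0 := by
  set N := n₁ + n₂ + n₃ with hN
  set S := topFactor q y
  set J := invQFact q
  set E := rogersSzegoInt q y
  have hJ : ∀ m, m < 0 → J m = 0 := fun m => invQFact_of_neg q
  have hE : ∀ m, m < 0 → E m = 0 := fun m => rogersSzegoInt_of_neg q y
  set D : ℤ → K := fun s => q ^ (s - n₃).toNat *
    (qInt q (s - n₂).toNat - qInt q (s - n₁).toNat) with hD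
  -- The telescoping certificate: the part of the middle summand with `E (N - 2 * s - 1)` left by
  -- `rogersSzegoInt_recurrence`. As `Y (s - 1)` carries `E (N - 2 * s + 1)`, all terms left in
  -- `key` are multiples of this one value.
  set Y : ℤ → K := fun s => S s * J (s - n₁) * J (s - n₂) * J (s - n₃) *
    (D s * ((1 - q) * y * q ^ (N - 2 * s).toNat)) * E (N - 2 * s - 1) with hY
  set V : ℤ → K := fun s => S s * J (s - (n₁ - 1)) * J (s - n₂) * J (s - n₃) *
    E (N - 2 * s - 1) with hV
  set W : ℤ → K := fun s => S s * J (s - n₁) * J (s - (n₂ - 1)) * J (s - n₃) *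
    E (N - 2 * s - 1) with hW
  have mid : ∀ s : ℤ, (qInt q n₁.toNat - qInt q n₂.toNat) * (1 + y * q) *
      (S s * E (N - 2 * s) * J (s - n₁) * J (s - n₂) * J (s - n₃)) =
      S s * J (s - n₁) * J (s - n₂) * J (s - n₃) *
        (D s * qInt q (N - 2 * s + 1).toNat) * E (N - 2 * s + 1) - Y s := by
    intro s
    simp only [hY]
    rcases lt_or_ge (s - n₁) 0 with ha | ha
    · simp [hJ _ ha]
    rcases lt_or_ge (s - n₂) 0 with hb | hb
    · simp [hJ _ hb]
    rcases lt_or_ge (s - n₃) 0 with hc | hc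
    · simp [hJ _ hc]
    rcases lt_or_ge (N - 2 * s) 0 with ht | ht
    -- If `N - 2 * s = -1`, then `E (N - 2 * s + 1) = E 0` need not vanish, but its factor `[0]_q`
    -- does.
    · rw [hE _ ht, hE (N - 2 * s - 1) (by omega), show (N - 2 * s + 1).toNat = 0 by omega, qInt_zero]
      ring
    have e1 := rogersSzegoInt_recurrence hq y ht
    have e2 : qInt q n₁.toNat - qInt q n₂.toNat = q ^ (N - 2 * s).toNat * D s := by
      simp only [hD]
      rw [show n₁.toNat = (s - n₃).toNat + (N - 2 * s).toNat + (s - n₂).toNat by omega,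
        show n₂.toNat = (s - n₃).toNat + (N - 2 * s).toNat + (s - n₁).toNat by omega,
        qInt_add, qInt_add q _ (s - n₁).toNat, pow_add]
      ring
    rw [e2]
    linear_combination (D s * S s * J (s - n₁) * J (s - n₂) * J (s - n₃)) * e1
  have key : ∀ s : ℤ, qInt q (n₁ + 1).toNat *
        (S s * E (n₁ + 1 + n₂ + n₃ - 2 * s) * J (s - (n₁ + 1)) * J (s - n₂) * J (s - n₃))
      - qInt q (n₂ + 1).toNat *
        (S s * E (n₁ + (n₂ + 1) + n₃ - 2 * s) * J (s - n₁) * J (s - (n₂ + 1)) * J (s - n₃))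
      + (qInt q n₁.toNat - qInt q n₂.toNat) * (1 + y * q) *
        (S s * E (N - 2 * s) * J (s - n₁) * J (s - n₂) * J (s - n₃))
      + y * qInt q n₁.toNat * V (s - 1) - y * qInt q n₂.toNat * W (s - 1)
      = Y (s - 1) - Y s := by
    intro s
    rw [mid, show n₁ + 1 + n₂ + n₃ - 2 * s = N - 2 * s + 1 by omega,
      show n₁ + (n₂ + 1) + n₃ - 2 * s = N - 2 * s + 1 by omega,
      show s - (n₁ + 1) = s - n₁ - 1 by omega, show s - (n₂ + 1) = s - n₂ - 1 by omega]
    simp only [hV, hW]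
    have hY1 : Y (s - 1) = S (s - 1) * J (s - n₁ - 1) * J (s - n₂ - 1) * J (s - n₃ - 1) *
        (q ^ (s - n₃ - 1).toNat * (qInt q (s - n₂ - 1).toNat - qInt q (s - n₁ - 1).toNat) *
          ((1 - q) * y * q ^ (N - 2 * s + 1 + 1).toNat)) * E (N - 2 * s + 1) := by
      simp only [hY, hD]
      rw [show N - 2 * (s - 1) - 1 = N - 2 * s + 1 by omega,
        show N - 2 * (s - 1) = N - 2 * s + 1 + 1 by omega,
        show s - 1 - n₁ = s - n₁ - 1 by omega, show s - 1 - n₂ = s - n₂ - 1 by omega,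
        show s - 1 - n₃ = s - n₃ - 1 by omega]
    rw [hY1, show N - 2 * (s - 1) - 1 = N - 2 * s + 1 by omega,
      show s - 1 - n₁ = s - n₁ - 1 by omega, show s - 1 - n₂ = s - n₂ - 1 by omega,
      show s - 1 - n₃ = s - n₃ - 1 by omega, show s - 1 - (n₁ - 1) = s - n₁ by omega,
      show s - 1 - (n₂ - 1) = s - n₂ by omega]
    rcases lt_or_ge (N - 2 * s + 1) 0 with ht | ht
    · rw [hE _ ht]; ring
    have := contiguity hq y (n₁ := n₁) (n₂ := n₂) (a := s - n₁) (b := s - n₂) (c := s - n₃)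
      (t := N - 2 * s + 1) (u := s) (by omega) (by omega) (by omega) ht h₁ h₂
    simp only [hD]
    linear_combination E (N - 2 * s + 1) * this
  have shift : ∀ f : ℤ → K, f (-1) = 0 → f M = 0 →
      ∑ s ∈ range (M + 1), f s = ∑ s ∈ range (M + 1), f (s - 1) :=
    fun f h0 hM => sum_range_int_shift h0 hM
  have S0 : S (-1) = 0 := if_neg (by norm_num)
  have EM : E (N - 2 * M - 1) = 0 := hE _ (by omega)
  have hYs := shift Y (by simp [hY, S0]) (by simp only [hY, EM, mul_zero])
  have hVs := shift V (by simp [hV, S0]) (by simp only [hV, EM, mul_zero])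
  have hWs := shift W (by simp [hW, S0]) (by simp only [hW, EM, mul_zero])
  have hG1 : tripleSum q y (M + 1) (n₁ - 1) n₂ n₃ = ∑ s ∈ range (M + 1), V s := by
    refine sum_congr rfl fun s _ => ?_
    simp only [hV]
    rw [show n₁ - 1 + n₂ + n₃ - 2 * (s : ℤ) = N - 2 * s - 1 by omega]
    ring
  have hG2 : tripleSum q y (M + 1) n₁ (n₂ - 1) n₃ = ∑ s ∈ range (M + 1), W s := by
    refine sum_congr rfl fun s _ => ?_
    simp only [hW]
    rw [show n₁ + (n₂ - 1) + n₃ - 2 * (s : ℤ) = N - 2 * s - 1 by omega]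
    ring
  rw [hG1, hG2, hVs, hWs]
  simp only [tripleSum, mul_sum, ← sum_add_distrib, ← sum_sub_distrib]
  calc _ = ∑ s ∈ range (M + 1), (Y ((s : ℤ) - 1) - Y s) := sum_congr rfl fun s _ => key s
    _ = 0 := by rw [sum_sub_distrib, hYs, sub_self]

theorem tripleSum_eq_of_lt (q y : K) {M : ℕ} {n₁ n₂ n₃ : ℤ} (hM : n₁ + n₂ + n₃ < M) :
    tripleSum q y M n₁ n₂ n₃ = tripleSum q y (n₁ + n₂ + n₃ + 1).toNat n₁ n₂ n₃ := by
  symm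
  refine sum_subset (range_subset_range.2 (by omega)) fun s _ hs => ?_
  rw [mem_range] at hs
  rcases lt_or_ge (n₁ + n₂ + n₃ - 2 * (s : ℤ)) 0 with h | h
  · rw [rogersSzegoInt_of_neg q y h]; ring
  · rw [invQFact_of_neg q (show (s : ℤ) - n₁ < 0 by omega)]; ring

theorem tripleSum_comm (q y : K) (M : ℕ) (n₁ n₂ n₃ : ℤ) :
    tripleSum q y M n₁ n₂ n₃ = tripleSum q y M n₂ n₃ n₁ := by
  refine sum_congr rfl fun s _ => ?_
  rw [show n₁ + n₂ + n₃ = n₂ + n₃ + n₁ by ring]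
  ring

/-- The explicit triple linearization coefficient. -/
def tripleCoeff (q y : K) (n₁ n₂ n₃ : ℕ) : K :=
  qFact q n₁ * qFact q n₂ * qFact q n₃ * tripleSum q y (n₁ + n₂ + n₃ + 1) n₁ n₂ n₃

theorem tripleCoeff_comm (q y : K) (n₁ n₂ n₃ : ℕ) :
    tripleCoeff q y n₁ n₂ n₃ = tripleCoeff q y n₂ n₃ n₁ := by
  rw [tripleCoeff, tripleCoeff, tripleSum_comm, show n₂ + n₃ + n₁ + 1 = n₁ + n₂ + n₃ + 1 by ring]
  ring

theorem tripleCoeff_eq (q y : K) {M n₁ n₂ n₃ : ℕ} (hM : n₁ + n₂ + n₃ < M) :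
    tripleCoeff q y n₁ n₂ n₃ =
      qFact q n₁ * qFact q n₂ * qFact q n₃ * tripleSum q y M n₁ n₂ n₃ := by
  rw [tripleCoeff, tripleSum_eq_of_lt q y (by omega), tripleSum_eq_of_lt q y (M := M) (by omega)]

theorem tripleCoeff_recurrence {q : K} (hq : ∀ m : ℕ, 0 < m → qInt q m ≠ 0) (y : K)
    (n₁ n₂ n₃ : ℕ) :
    tripleCoeff q y (n₁ + 1) n₂ n₃ =
      tripleCoeff q y n₁ (n₂ + 1) n₃
      + ((y * qInt q (n₂ + 1) + qInt q n₂) - (y * qInt q (n₁ + 1) + qInt q n₁)) *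
        tripleCoeff q y n₁ n₂ n₃
      + y * qInt q n₂ ^ 2 * tripleCoeff q y n₁ (n₂ - 1) n₃
      - y * qInt q n₁ ^ 2 * tripleCoeff q y (n₁ - 1) n₂ n₃ := by
  set M := n₁ + n₂ + n₃ + 1 with hM
  have h := tripleSum_recurrence hq y (M := M) (n₁ := n₁) (n₂ := n₂) (n₃ := n₃)
    (by omega) (by omega) (by omega)
  rw [tripleCoeff_eq q y (M := M + 1) (by omega), tripleCoeff_eq q y (M := M + 1) (by omega),
    tripleCoeff_eq q y (M := M + 1) (by omega), tripleCoeff_eq q y (M := M + 1) (by omega),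
    tripleCoeff_eq q y (M := M + 1) (by omega)]
  have pred : ∀ n : ℕ, ∀ g : ℤ → K, qInt q n ^ 2 * (qFact q (n - 1) * g ((n - 1 : ℕ) : ℤ)) =
      qInt q n * (qFact q n * g ((n : ℤ) - 1)) := by
    intro n g
    cases n with
    | zero => simp [qInt_zero]
    | succ n => rw [Nat.add_sub_cancel, qFact_succ, Nat.cast_succ, add_sub_cancel_right]; ring
  have p1 := pred n₁ fun m => tripleSum q y (M + 1) m n₂ n₃
  have p2 := pred n₂ fun m => tripleSum q y (M + 1) n₁ m n₃
  -- In this form the difference of two diagonal coefficients is `1 + y q` times a difference of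
  -- `q`-integers.
  have b1 : ∀ n, y * qInt q (n + 1) + qInt q n = y + (1 + y * q) * qInt q n := by
    intro n; rw [add_comm n, qInt_add]; simp [qInt]; ring
  rw [b1, b1]
  simp only [Int.toNat_natCast, Int.toNat_natCast_add_one] at h
  push_cast
  simp only [qFact_succ]
  linear_combination (qFact q n₁ * qFact q n₂ * qFact q n₃) * h
    + y * qFact q n₂ * qFact q n₃ * p1 - y * qFact q n₁ * qFact q n₃ * p2

/-- A nonzero summand needs `n ≤ s` and `2 s ≤ n`, which forces `n = 0`. -/
theorem tripleCoeff_zero_zero (q y : K) (n : ℕ) :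
    tripleCoeff q y 0 0 n = if n = 0 then 1 else 0 := by
  split_ifs with h
  · subst h
    simp [tripleCoeff, tripleSum, qFact_zero, topFactor, rogersSzegoInt, rogersSzego, invQFact]
  · rw [tripleCoeff, tripleSum, sum_eq_zero, mul_zero]
    intro s _
    rcases lt_or_ge ((s : ℤ) - n) 0 with hs | hs
    · rw [invQFact_of_neg q hs, mul_zero]
    · rw [rogersSzegoInt_of_neg q y (by omega)]; ring

theorem tripleCoeff_eq_sum {q : K} (hq : ∀ m : ℕ, 0 < m → qInt q m ≠ 0) (y : K) (n₁ n₂ n₃ : ℕ) :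
    tripleCoeff q y n₁ n₂ n₃ =
      ∑ s ∈ (range (n₁ + n₂ + n₃ + 1)).filter
          (fun s => n₁ ≤ s ∧ n₂ ≤ s ∧ n₃ ≤ s ∧ 2 * s ≤ n₁ + n₂ + n₃),
        (qFact q n₁ * qFact q n₂ * qFact q n₃ * qFact q s * y ^ s) /
          (qFact q (n₁ + n₂ + n₃ - 2 * s) * qFact q (s - n₃) * qFact q (s - n₂) *
            qFact q (s - n₁)) *
        ∑ k ∈ range (n₁ + n₂ + n₃ - 2 * s + 1),
          qBinom q (n₁ + n₂ + n₃ - 2 * s) k * y ^ k *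
            q ^ ((k + 1).choose 2 + (n₁ + n₂ + n₃ - 2 * s - k).choose 2) := by
  rw [tripleCoeff, tripleSum, mul_sum, sum_filter]
  refine sum_congr rfl fun s _ => ?_
  split_ifs with h
  · rw [sum_qBinom_eq_rogersSzego hq, topFactor, if_pos (by omega), rogersSzegoInt,
      if_pos (by omega), invQFact, if_pos (by omega), invQFact, if_pos (by omega), invQFact,
      if_pos (by omega), Int.toNat_natCast,
      show ((n₁ : ℤ) + n₂ + n₃ - 2 * s).toNat = n₁ + n₂ + n₃ - 2 * s by omega,
      show ((s : ℤ) - n₁).toNat = s - n₁ by omega, show ((s : ℤ) - n₂).toNat = s - n₂ by omega,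
      show ((s : ℤ) - n₃).toNat = s - n₃ by omega]
    have g0 := qFact_ne_zero hq (n₁ + n₂ + n₃ - 2 * s)
    have g1 := qFact_ne_zero hq (s - n₁)
    have g2 := qFact_ne_zero hq (s - n₂)
    have g3 := qFact_ne_zero hq (s - n₃)
    field_simp
  · by_cases c1 : n₁ ≤ s
    · by_cases c2 : n₂ ≤ s
      · by_cases c3 : n₃ ≤ s
        · rw [rogersSzegoInt_of_neg q y (by omega)]; ring
        · rw [invQFact_of_neg q (m := (s : ℤ) - n₃) (by omega)]; ring
      · rw [invQFact_of_neg q (m := (s : ℤ) - n₂) (by omega)]; ring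
    · rw [invQFact_of_neg q (m := (s : ℤ) - n₁) (by omega)]; ring

theorem momentFunctional_mul_mul {q : K} (hq : ∀ m : ℕ, 0 < m → qInt q m ≠ 0) (y : K)
    (n₁ n₂ n₃ : ℕ) :
    momentFunctional q y (qLaguerre q y n₁ * (qLaguerre q y n₂ * qLaguerre q y n₃)) =
      tripleCoeff q y n₁ n₂ n₃ := by
  have h0 : ∀ m l, momentFunctional q y (qLaguerre q y 0 * (qLaguerre q y m * qLaguerre q y l)) =
      tripleCoeff q y 0 m l := by
    intro m l
    -- Cyclic symmetry puts the index `0` last, so the recurrence acts on the other two; its initial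
    -- row is the value at a single `L_m`.
    rw [tripleCoeff_comm, qLaguerre, one_mul]
    refine eq_of_linearization_recurrence (fun n => y * qInt q (n + 1) + qInt q n)
      (fun n => y * qInt q n ^ 2)
      (f := fun m l => momentFunctional q y (qLaguerre q y m * qLaguerre q y l))
      (g := fun m l => tripleCoeff q y m l 0) (fun n m => ?_)
      (fun n m => tripleCoeff_recurrence hq y n m 0) (fun m => ?_) m l
    · simpa using momentFunctional_recurrence q y 1 n m
    · simp only [tripleCoeff_comm q y 0 m 0, tripleCoeff_comm q y m 0 0, tripleCoeff_zero_zero,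
        qLaguerre, one_mul, momentFunctional_qLaguerre]
  exact eq_of_linearization_recurrence (fun n => y * qInt q (n + 1) + qInt q n)
    (fun n => y * qInt q n ^ 2)
    (f := fun n m => momentFunctional q y
      (qLaguerre q y n * (qLaguerre q y m * qLaguerre q y n₃)))
    (g := fun n m => tripleCoeff q y n m n₃)
    (fun n m => momentFunctional_recurrence q y (qLaguerre q y n₃) n m)
    (fun n m => tripleCoeff_recurrence hq y n m n₃) (fun m => h0 m n₃) n₁ n₂

end Triple

end QLaguerre

theorem theorem4p2 {K : Type*} [Field K] [CharZero K] (q y : K)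
    (hq : ∀ m : ℕ, 0 < m → QLaguerre.qInt q m ≠ 0) :
    -- the `q`-Laguerre polynomials are the rescaled Al-Salam-Chihara polynomials
    (∀ r : K, r ≠ 0 → r ^ 2 = y → q ≠ 1 → ∀ n : ℕ,
      QLaguerre.qLaguerre q y n = QLaguerre.rescaledAlSalamChihara q y r n) ∧
    -- their triple linearization coefficients
    (∀ n₁ n₂ n₃ : ℕ,
      QLaguerre.linCoeff q y [n₁, n₂, n₃] =
        ∑ s ∈ (Finset.range (n₁ + n₂ + n₃ + 1)).filter
            (fun s => n₁ ≤ s ∧ n₂ ≤ s ∧ n₃ ≤ s ∧ 2 * s ≤ n₁ + n₂ + n₃),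
          (QLaguerre.qFact q n₁ * QLaguerre.qFact q n₂ * QLaguerre.qFact q n₃ *
              QLaguerre.qFact q s * y ^ s) /
            (QLaguerre.qFact q (n₁ + n₂ + n₃ - 2 * s) * QLaguerre.qFact q (s - n₃) *
              QLaguerre.qFact q (s - n₂) * QLaguerre.qFact q (s - n₁)) *
          ∑ k ∈ Finset.range (n₁ + n₂ + n₃ - 2 * s + 1),
            QLaguerre.qBinom q (n₁ + n₂ + n₃ - 2 * s) k * y ^ k *
              q ^ ((k + 1).choose 2 + (n₁ + n₂ + n₃ - 2 * s - k).choose 2)) := by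
  refine ⟨fun r hr hy hq1 n => QLaguerre.qLaguerre_eq_rescaledAlSalamChihara hr hy hq1 n,
    fun n₁ n₂ n₃ => ?_⟩
  rw [← QLaguerre.tripleCoeff_eq_sum hq, ← QLaguerre.momentFunctional_mul_mul hq]
  simp [QLaguerre.linCoeff]
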